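/- Let $r\ge 2$ and $n\ge 1$ be integers, and let $\mathbb X$ be a set of $2rn$ nodes in which every $x$ has a domain $d_x\in\{1,2\}$ and a class $y_x\in\{1,\dots,r\}$, with exactly $n$ nodes for each pair of a domain and a class. Let $\rho,\alpha,\beta,\gamma\in[0,1]$ satisfy $\rho>\max\{\alpha,\beta\}$ and $\min\{\alpha,\beta\}>\gamma$. Draw a random undirected, unweighted graph $G=(\mathbb X,E)$ from the stochastic block model: independently for all unordered pairs $\{x,x'\}$ (with $x=x'$ allowed), the pair is an edge with probability $\rho$ if $y_x=y_{x'},d_x=d_{x'}$; $\alpha$ if $y_x=y_{x'},d_x\ne d_{x'}$; $\beta$ if $y_x\ne y_{x'},d_x=d_{x'}$; and $\gamma$ if $y_x\ne y_{x'},d_x\neq d_{x'}$. Let $A\in\{0,1\}^{\mathbb X\times\mathbb X}$ be the adjacency matrix of $G$, let $S_+$ be the distribution of positive pairs, $S_+(x,x^+)=A_{xx^+}/\sum_{u,u'}A_{uu'}$, and let $P_U$ be the uniform distribution on $\mathbb X$. Put $k=r+1$, and let the pre-trained encoder $\widehat\phi:\mathbb X\to\mathbb R^{k}$ be a global minimizer,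 over all maps $\phi:\mathbb X\to\mathbb R^k$, of the spectral contrastive loss $$-2\,\mathbb E_{(x,x^+)\sim S_+}\big[\phi(x)^\top\phi(x^+)\big]+\mathbb E_{x,x'\sim P_U}\big[(\phi(x)^\top\phi(x'))^2\big],$$ where $x,x'\sim P_U$ are independent. **Proposition.** There are absolute constants $c,C>0$ and a polynomial $p$ such that for all such $r,n,\rho,\alpha,\beta,\gamma$ with $$n\ \ge\ c\cdot\frac{r}{\min\{\alpha-\gamma,\beta-\gamma\}^2},$$ with probability at least $0.999$ over the random graph the following holds: for every such minimizer $\widehat\phi$ there is a linear classifier $h_{\mathrm{dom}}:\mathbb R^{k}\to\{1,2\}$, that is, $h_{\mathrm{dom}}(z)=\arg\max_{i\in\{1,2\}}(Bz)_i$ for some $B\in\mathbb R^{2\times k}$ (ties being broken in favour of $i=1$), whose domain 0-1 error satisfies $$\Pr_{x\sim P_U}\big[h_{\mathrm{dom}}(\widehat\phi(x))\ne d_x\big]\ \le\ C\cdot\frac{1}{\min\{\alpha-\gamma,\beta-\gamma\}^6\,n}\cdot p(r).$$ -/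

import Mathlib

open MeasureTheory ProbabilityTheory
open scoped RealInnerProductSpace unitInterval

noncomputable section

namespace ContrastiveSBM

/-- The nodes (inputs): there are two domains, `r` classes, and `n` points for every pair of a
domain and a class.  Domain `0` is the source and domain `1` is the target. -/
abbrev Node (r n : ℕ) : Type := Fin 2 × Fin r × Fin n

/-- The domain `d_x` of a node. -/
def dom {r n : ℕ} (x : Node r n) : Fin 2 := x.1

/-- The class `y_x` of a node. -/
def cls {r n : ℕ} (x : Node r n) : Fin r := x.2.1

/-- The probability that the unordered pair `{x, x'}` (where `x = x'` is allowed) is an edge. -/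
def edgeProb {r n : ℕ} (ρ α β γ : I) : Sym2 (Node r n) → I :=
  Sym2.lift ⟨fun x x' =>
      if cls x = cls x' then (if dom x = dom x' then ρ else α)
      else (if dom x = dom x' then β else γ),
    fun x x' => by simp only [eq_comm]⟩

/-- An undirected, unweighted graph on `V`, self-loops allowed, given by the indicator of its
edge set. -/
abbrev Graph (V : Type) : Type := Sym2 V → Bool

/-- The law of the stochastic block model: all edges are sampled independently, the edge `e` being
present with probability `edgeProb ρ α β γ e`. -/
def sbm (r n : ℕ) (ρ α β γ : I) : Measure (Graph (Node r n)) :=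
  Measure.pi fun e => bernoulliMeasure true false (edgeProb ρ α β γ e)

instance (r n : ℕ) (ρ α β γ : I) : IsProbabilityMeasure (sbm r n ρ α β γ) := by
  unfold sbm; infer_instance

variable {V : Type}

/-- The adjacency matrix of a graph. -/
def adj (G : Graph V) : Matrix V V ℝ :=
  Matrix.of fun x x' => if G s(x, x') then 1 else 0

variable [Fintype V]

/-- The spectral contrastive loss of an encoder `φ : V → ℝᵏ`.  Positive pairs are uniform over the
edges of `G`, that is, `(x, x⁺)` has probability `A x x⁺ / ∑ A`; the two members of a negative pair
are independent and uniform over `V`. -/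
def pretrainLoss {k : ℕ} (G : Graph V) (φ : V → EuclideanSpace ℝ (Fin k)) : ℝ :=
  -2 * ∑ x, ∑ x', (adj G x x' / ∑ u, ∑ u', adj G u u') * ⟪φ x, φ x'⟫
    + ∑ x, ∑ x', (1 / (Fintype.card V : ℝ) ^ 2) * ⟪φ x, φ x'⟫ ^ 2

/-- `φ` is an encoder learned by contrastive pre-training on the graph `G`: a global minimizer of
the spectral contrastive loss among all maps `V → ℝᵏ`. -/
def IsPretrained {k : ℕ} (G : Graph V) (φ : V → EuclideanSpace ℝ (Fin k)) : Prop :=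
  ∀ ψ : V → EuclideanSpace ℝ (Fin k), pretrainLoss G φ ≤ pretrainLoss G ψ

/-- Pre-trained encoders exist, for every graph and every feature dimension. -/
theorem exists_isPretrained (k : ℕ) (G : Graph V) :
    ∃ φ : V → EuclideanSpace ℝ (Fin k), IsPretrained G φ := by
  rcases isEmpty_or_nonempty V with hV | hV
  · exact ⟨0, fun ψ => le_of_eq (congrArg _ (Subsingleton.elim _ _))⟩
  have hcont : Continuous fun φ : V → EuclideanSpace ℝ (Fin k) => pretrainLoss G φ := by
    unfold pretrainLoss; fun_prop
  set N : ℝ := (Fintype.card V : ℝ) with hN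
  have hNpos : 0 < N := by rw [hN]; exact_mod_cast Fintype.card_pos
  set q : ℝ := 1 / N ^ 2 with hq
  have hqpos : 0 < q := by positivity
  set w : V → V → ℝ := fun x x' => adj G x x' / ∑ u, ∑ u', adj G u u' with hw
  set c : ℝ := ∑ x, ∑ x', (2 / q) * w x x' ^ 2 with hc
  have key : ∀ φ : V → EuclideanSpace ℝ (Fin k),
      q * ‖φ‖ - (c + N * q) ≤ pretrainLoss G φ := by
    intro φ
    have h1 : pretrainLoss G φ
        = ∑ x, ∑ x', (-2 * (w x x' * ⟪φ x, φ x'⟫) + q * ⟪φ x, φ x'⟫ ^ 2) := by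
      simp only [pretrainLoss, Finset.sum_add_distrib, Finset.mul_sum, hw, hq, hN]
    have h2 : ∑ x, ∑ x', ((q / 2) * ⟪φ x, φ x'⟫ ^ 2 - (2 / q) * w x x' ^ 2)
        ≤ pretrainLoss G φ := by
      rw [h1]
      refine Finset.sum_le_sum fun x _ => Finset.sum_le_sum fun x' _ => ?_
      have : (q / 2) * ⟪φ x, φ x'⟫ ^ 2 - 2 * (w x x' * ⟪φ x, φ x'⟫) + (2 / q) * w x x' ^ 2
          = (q / 2) * (⟪φ x, φ x'⟫ - 2 / q * w x x') ^ 2 := by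
        field_simp; ring
      have h0 : 0 ≤ (q / 2) * (⟪φ x, φ x'⟫ - 2 / q * w x x') ^ 2 := by positivity
      linarith
    have h3 : ∑ x, (q * ‖φ x‖ - q) ≤ ∑ x, ∑ x', (q / 2) * ⟪φ x, φ x'⟫ ^ 2 := by
      refine Finset.sum_le_sum fun x _ => ?_
      refine le_trans ?_ (Finset.single_le_sum (f := fun x' => (q / 2) * ⟪φ x, φ x'⟫ ^ 2)
        (fun x' _ => by positivity) (Finset.mem_univ x))
      simp only [real_inner_self_eq_norm_sq]
      have : 0 ≤ (‖φ x‖ ^ 2 - 1) ^ 2 + 2 * (‖φ x‖ - 1 / 2) ^ 2 + 1 / 2 := by positivity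
      nlinarith
    have h4 : ‖φ‖ ≤ ∑ x, ‖φ x‖ :=
      (pi_norm_le_iff_of_nonneg (Finset.sum_nonneg fun _ _ => norm_nonneg _)).2 fun x =>
        Finset.single_le_sum (f := fun x => ‖φ x‖) (fun _ _ => norm_nonneg _) (Finset.mem_univ x)
    have h5 : ∑ x, (q * ‖φ x‖ - q) = q * ∑ x, ‖φ x‖ - N * q := by
      simp [Finset.sum_sub_distrib, Finset.mul_sum, hN]
    simp only [Finset.sum_sub_distrib] at h2
    have h6 := mul_le_mul_of_nonneg_left h4 hqpos.le
    linarith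
  have hlim : Filter.Tendsto (fun φ : V → EuclideanSpace ℝ (Fin k) => pretrainLoss G φ)
      (Filter.cocompact _) Filter.atTop := by
    refine Filter.tendsto_atTop_mono key ?_
    exact Filter.tendsto_atTop_add_const_right _ _
      ((tendsto_norm_cocompact_atTop).const_mul_atTop hqpos)
  exact hcont.exists_forall_le hlim

/-- The linear two-domain classifier with parameters `B : ℝ^{2 × k}`, which maps `z` to
`argmax_i (B z)_i`, the smaller index being taken in case of a tie. -/
def linearClassifier {k : ℕ} (B : Matrix (Fin 2) (Fin k) ℝ) (z : EuclideanSpace ℝ (Fin k)) :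
    Fin 2 :=
  if (B.mulVec z) 1 ≤ (B.mulVec z) 0 then 0 else 1

/-- A domain classifier on `ℝᵏ` is linear if it is the argmax of linear scores. -/
def IsLinearClassifier {k : ℕ} (h : EuclideanSpace ℝ (Fin k) → Fin 2) : Prop :=
  ∃ B : Matrix (Fin 2) (Fin k) ℝ, h = linearClassifier B

/-- The 0-1 loss for domain classification of `h ∘ φ`, under the uniform distribution over the
nodes of both domains. -/
def domainZeroOneLoss {r n k : ℕ} (h : EuclideanSpace ℝ (Fin k) → Fin 2)
    (φ : Node r n → EuclideanSpace ℝ (Fin k)) : ℝ :=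
  ∑ x : Node r n, (1 / (Fintype.card (Node r n) : ℝ)) * (if h (φ x) ≠ dom x then 1 else 0)

end ContrastiveSBM

end

/-!
Expanding the square, the minimizers of the loss are the matrices `X` for which the Gram matrix
`X Xᵀ` is nearest in Frobenius norm to a positive multiple of the adjacency matrix `A`. For such an
`X` and every vector `u` orthogonal to its columns, the Rayleigh quotient of `A` at `u` is, by a
min-max argument, at most the positive part of its maximum over the orthogonal complement of any
given `k` vectors.

Take for these vectors the sign vector of the domains and the indicators of the `r` classes. On
their complement the mean of `A` has Rayleigh quotient at most `n (ρ - α - β + γ)⁺`, whereas the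
sign vector is an eigenvector of the mean whose eigenvalue is larger by at least `n r (β - γ) / 2`.
The Davis–Kahan argument then shows that the sign vector is close to the column space of `X` in
mean square, so that thresholding a linear function of the features recovers most of the domains.
The noise `E = A - 𝔼 A` enters only through its action on the sign vector, whose second moment is
explicit, and through its operator norm, which is bounded by the trace of `E⁴`: in the expectation
of this trace only the degenerate closed walks of length four survive.
-/

namespace ContrastiveSBM

open Matrix

section LowRank

variable {V κ : Type*}

theorem add_vecMulVec_mul_transpose [Fintype κ] (X : Matrix V κ ℝ) (q : V → ℝ) {b : κ → ℝ}
    (hb : b ⬝ᵥ b ≠ 0) :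
    (X + (b ⬝ᵥ b)⁻¹ • vecMulVec (q - X *ᵥ b) b) * (X + (b ⬝ᵥ b)⁻¹ • vecMulVec (q - X *ᵥ b) b)ᵀ
      = X * Xᵀ + (b ⬝ᵥ b)⁻¹ • (vecMulVec q q - vecMulVec (X *ᵥ b) (X *ᵥ b)) := by
  simp only [transpose_add, transpose_smul, transpose_vecMulVec, Matrix.add_mul, Matrix.mul_add,
    Matrix.smul_mul, Matrix.mul_smul, vecMulVec_mul_vecMulVec, vecMulVec_smul, inv_smul_smul₀ hb]
  rw [mul_vecMulVec, vecMulVec_mul, vecMul_transpose]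
  simp only [sub_vecMulVec, vecMulVec_sub]
  module

variable [Fintype V]

theorem real_dotProduct_self_nonneg (v : V → ℝ) : 0 ≤ v ⬝ᵥ v :=
  dotProduct_star_self_nonneg v

theorem real_dotProduct_sq_le (v w : V → ℝ) : (v ⬝ᵥ w) ^ 2 ≤ (v ⬝ᵥ v) * (w ⬝ᵥ w) := by
  simpa only [dotProduct, ← sq] using Finset.sum_mul_sq_le_sq_mul_sq Finset.univ v w

/-- The squared Frobenius norm of a real matrix. -/
def frobSq (M : Matrix V V ℝ) : ℝ := (Mᵀ * M).trace

theorem frobSq_eq_sum (M : Matrix V V ℝ) : frobSq M = ∑ x, ∑ y, M x y ^ 2 := by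
  simp only [frobSq, trace, diag_apply, mul_apply, transpose_apply, ← sq]
  exact Finset.sum_comm

theorem frobSq_add (M N : Matrix V V ℝ) :
    frobSq (M + N) = frobSq M + 2 * (Mᵀ * N).trace + frobSq N := by
  have hcomm : (Nᵀ * M).trace = (Mᵀ * N).trace := by
    rw [← trace_transpose, transpose_mul, transpose_transpose]
  simp only [frobSq, transpose_add, Matrix.add_mul, Matrix.mul_add, trace_add, hcomm]
  ring

theorem frobSq_smul (c : ℝ) (M : Matrix V V ℝ) : frobSq (c • M) = c ^ 2 * frobSq M := by
  simp only [frobSq, transpose_smul, Matrix.smul_mul, Matrix.mul_smul, trace_smul, smul_eq_mul]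
  ring

theorem frobSq_vecMulVec_sub (p q : V → ℝ) :
    frobSq (vecMulVec q q - vecMulVec p p)
      = (q ⬝ᵥ q) ^ 2 - 2 * (p ⬝ᵥ q) ^ 2 + (p ⬝ᵥ p) ^ 2 := by
  simp only [frobSq, transpose_sub, transpose_vecMulVec, Matrix.sub_mul, Matrix.mul_sub,
    vecMulVec_mul_vecMulVec, vecMulVec_smul, trace_sub, trace_smul, trace_vecMulVec, smul_eq_mul,
    dotProduct_comm q p]
  ring

theorem trace_transpose_mul_vecMulVec (M : Matrix V V ℝ) (q : V → ℝ) :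
    (Mᵀ * vecMulVec q q).trace = q ⬝ᵥ M *ᵥ q := by
  rw [mul_vecMulVec, trace_vecMulVec, mulVec_transpose, dotProduct_mulVec]

theorem frobSq_nonneg (M : Matrix V V ℝ) : 0 ≤ frobSq M := by
  rw [frobSq_eq_sum]
  positivity

theorem mulVec_dotProduct_self_le (M : Matrix V V ℝ) (v : V → ℝ) :
    (M *ᵥ v) ⬝ᵥ (M *ᵥ v) ≤ frobSq M * (v ⬝ᵥ v) := by
  calc (M *ᵥ v) ⬝ᵥ (M *ᵥ v) = ∑ x, (M x ⬝ᵥ v) ^ 2 := by simp only [dotProduct, mulVec, sq]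
    _ ≤ ∑ x, (M x ⬝ᵥ M x) * (v ⬝ᵥ v) :=
      Finset.sum_le_sum fun x _ => real_dotProduct_sq_le (M x) v
    _ = frobSq M * (v ⬝ᵥ v) := by
      simp only [frobSq_eq_sum, Finset.sum_mul, dotProduct, sq]

/-- `frobSq (E * E)` is the sum of the fourth powers of the eigenvalues of `E`. -/
theorem dotProduct_mulVec_le_of_frobSq_mul_self_le {E : Matrix V V ℝ} (hE : E.IsSymm) {η : ℝ}
    (hη : 0 ≤ η) (h : frobSq (E * E) ≤ η ^ 4) (v : V → ℝ) :
    v ⬝ᵥ E *ᵥ v ≤ η * (v ⬝ᵥ v) := by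
  have hv := real_dotProduct_self_nonneg v
  have h₁ : (v ⬝ᵥ E *ᵥ v) ^ 2 ≤ (v ⬝ᵥ v) * ((E *ᵥ v) ⬝ᵥ (E *ᵥ v)) := real_dotProduct_sq_le _ _
  have h₂ : ((E *ᵥ v) ⬝ᵥ (E *ᵥ v)) ^ 2 ≤ (η ^ 2 * (v ⬝ᵥ v)) ^ 2 := calc
    ((E *ᵥ v) ⬝ᵥ (E *ᵥ v)) ^ 2 = (v ⬝ᵥ (E * E) *ᵥ v) ^ 2 := by
      rw [← dotProduct_transpose_mulVec, hE.eq, mulVec_mulVec]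
    _ ≤ (v ⬝ᵥ v) * (((E * E) *ᵥ v) ⬝ᵥ ((E * E) *ᵥ v)) := real_dotProduct_sq_le _ _
    _ ≤ (v ⬝ᵥ v) * (η ^ 4 * (v ⬝ᵥ v)) := by
      gcongr
      exact (mulVec_dotProduct_self_le _ _).trans (by gcongr)
    _ = (η ^ 2 * (v ⬝ᵥ v)) ^ 2 := by ring
  refine le_of_sq_le_sq ?_ (by positivity)
  calc (v ⬝ᵥ E *ᵥ v) ^ 2 ≤ (v ⬝ᵥ v) * ((E *ᵥ v) ⬝ᵥ (E *ᵥ v)) := h₁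
    _ ≤ (v ⬝ᵥ v) * (η ^ 2 * (v ⬝ᵥ v)) := by
      gcongr
      exact le_of_sq_le_sq h₂ (by positivity)
    _ = (η * (v ⬝ᵥ v)) ^ 2 := by ring

theorem eq_zero_of_forall_mul_nonneg {f : ℝ → ℝ} (hf : ContinuousAt f 0)
    (h : ∀ t, 0 ≤ t * f t) : f 0 = 0 := by
  refine le_antisymm ?_ ?_
  · refine le_of_tendsto (hf.tendsto.mono_left nhdsWithin_le_nhds : Filter.Tendsto f
      (nhdsWithin 0 (Set.Iio 0)) _) (eventually_mem_nhdsWithin.mono fun t ht => ?_)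
    exact nonpos_of_mul_nonneg_right (h t) ht
  · refine ge_of_tendsto (hf.tendsto.mono_left nhdsWithin_le_nhds : Filter.Tendsto f
      (nhdsWithin 0 (Set.Ioi 0)) _) (eventually_mem_nhdsWithin.mono fun t ht => ?_)
    exact nonneg_of_mul_nonneg_right (h t) ht

variable [Fintype κ]

/-- `X` is a global minimizer of the Frobenius distance from `X * Xᵀ` to the target `T`. -/
def IsBestFactor (T : Matrix V V ℝ) (X : Matrix V κ ℝ) : Prop :=
  ∀ Y : Matrix V κ ℝ, frobSq (X * Xᵀ - T) ≤ frobSq (Y * Yᵀ - T)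

theorem IsBestFactor.of_smul {T : Matrix V V ℝ} {X : Matrix V κ ℝ} {c : ℝ} (hc : 0 < c)
    (hX : IsBestFactor (c • T) X) : IsBestFactor T ((√c)⁻¹ • X) := by
  have hcc : √c * √c = c := Real.mul_self_sqrt hc.le
  have hc' : √c ≠ 0 := (Real.sqrt_pos.2 hc).ne'
  have hdist (Z : Matrix V κ ℝ) : c ^ 2 * frobSq (Z * Zᵀ - T)
      = frobSq ((√c • Z) * (√c • Z)ᵀ - c • T) := by
    rw [← frobSq_smul, transpose_smul, Matrix.smul_mul, Matrix.mul_smul, smul_smul, hcc, smul_sub]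
  intro Y
  refine le_of_mul_le_mul_left ?_ (pow_pos hc 2)
  rw [hdist, hdist, smul_inv_smul₀ hc']
  exact hX _

/-- Optimality of `X` against the competitor in which the rank-one piece `X b bᵀ` is replaced by
`q bᵀ`. -/
theorem IsBestFactor.rankOne_update_nonneg {T : Matrix V V ℝ} {X : Matrix V κ ℝ}
    (hX : IsBestFactor T X) (b : κ → ℝ) (q : V → ℝ) :
    0 ≤ 2 * (b ⬝ᵥ b) *
        (q ⬝ᵥ (X * Xᵀ - T) *ᵥ q - (X *ᵥ b) ⬝ᵥ (X * Xᵀ - T) *ᵥ (X *ᵥ b))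
      + ((q ⬝ᵥ q) ^ 2 - 2 * ((X *ᵥ b) ⬝ᵥ q) ^ 2 + ((X *ᵥ b) ⬝ᵥ (X *ᵥ b)) ^ 2) := by
  rcases eq_or_ne b 0 with rfl | hb
  · simpa using sq_nonneg (q ⬝ᵥ q)
  have hb' : b ⬝ᵥ b ≠ 0 := mt dotProduct_self_eq_zero.1 hb
  have h := hX (X + (b ⬝ᵥ b)⁻¹ • vecMulVec (q - X *ᵥ b) b)
  rw [add_vecMulVec_mul_transpose X q hb', add_sub_right_comm, frobSq_add, Matrix.mul_smul,
    trace_smul, Matrix.mul_sub, trace_sub, trace_transpose_mul_vecMulVec,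
    trace_transpose_mul_vecMulVec, frobSq_smul, frobSq_vecMulVec_sub, smul_eq_mul] at h
  have h' := mul_nonneg (sq_nonneg (b ⬝ᵥ b)) (sub_nonneg.2 h)
  field_simp at h'
  linarith

theorem mulVec_eq_zero_of_forall_update_nonneg {R : Matrix V V ℝ} (hR : R.IsSymm) {c : ℝ}
    (hc : c ≠ 0) {p : V → ℝ}
    (h : ∀ q : V → ℝ, 0 ≤ 2 * c * (q ⬝ᵥ R *ᵥ q - p ⬝ᵥ R *ᵥ p)
      + ((q ⬝ᵥ q) ^ 2 - 2 * (p ⬝ᵥ q) ^ 2 + (p ⬝ᵥ p) ^ 2)) :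
    R *ᵥ p = 0 := by
  obtain ⟨w, hw⟩ : ∃ w, R *ᵥ p = w := ⟨_, rfl⟩
  have hpw : p ⬝ᵥ R *ᵥ w = w ⬝ᵥ w := by rw [← dotProduct_transpose_mulVec, hR.eq, hw]
  have hlin := eq_zero_of_forall_mul_nonneg
    (f := fun t => 4 * c * (w ⬝ᵥ w)
      + t * (2 * c * (w ⬝ᵥ R *ᵥ w) + 2 * (p ⬝ᵥ p) * (w ⬝ᵥ w) + 2 * (p ⬝ᵥ w) ^ 2)
      + t ^ 2 * (4 * (p ⬝ᵥ w) * (w ⬝ᵥ w)) + t ^ 3 * (w ⬝ᵥ w) ^ 2)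
    (by fun_prop) fun t => by
      have ht := h (p + t • w)
      simp only [mulVec_add, mulVec_smul, add_dotProduct, dotProduct_add, smul_dotProduct,
        dotProduct_smul, smul_eq_mul, dotProduct_comm w p, hw, hpw] at ht
      linarith
  rw [hw]
  exact dotProduct_self_eq_zero.1 (by simpa [hc] using hlin)

theorem IsBestFactor.mul_transpose_mul_eq {T : Matrix V V ℝ} (hT : T.IsSymm) {X : Matrix V κ ℝ}
    (hX : IsBestFactor T X) : X * Xᵀ * X = T * X := by
  classical
  have hR : (X * Xᵀ - T).IsSymm := by
    rw [IsSymm, transpose_sub, transpose_mul, transpose_transpose, hT.eq]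
  rw [← sub_eq_zero, ← Matrix.sub_mul]
  refine Matrix.ext_of_mulVec_single fun i => ?_
  rw [← mulVec_mulVec, zero_mulVec]
  exact mulVec_eq_zero_of_forall_update_nonneg hR (c := Pi.single i 1 ⬝ᵥ Pi.single i 1) (by simp)
    (hX.rankOne_update_nonneg _)

theorem dotProduct_mulVec_eq_zero {X : Matrix V κ ℝ} {u : V → ℝ} (hu : Xᵀ *ᵥ u = 0) (b : κ → ℝ) :
    u ⬝ᵥ X *ᵥ b = 0 := by
  rw [← transpose_transpose X, dotProduct_transpose_mulVec, hu, dotProduct_zero]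

theorem IsBestFactor.mulVec_mulVec_eq {T : Matrix V V ℝ} (hT : T.IsSymm) {X : Matrix V κ ℝ}
    (hX : IsBestFactor T X) (b : κ → ℝ) : T *ᵥ (X *ᵥ b) = X *ᵥ (Xᵀ *ᵥ (X *ᵥ b)) := by
  simp only [mulVec_mulVec, ← hX.mul_transpose_mul_eq hT, Matrix.mul_assoc]

theorem IsBestFactor.rayleigh_mul_le {T : Matrix V V ℝ} (hT : T.IsSymm) {X : Matrix V κ ℝ}
    (hX : IsBestFactor T X) {u : V → ℝ} (hu : Xᵀ *ᵥ u = 0) (b : κ → ℝ) :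
    (u ⬝ᵥ T *ᵥ u) * (b ⬝ᵥ b) ≤ (u ⬝ᵥ u) * ((X *ᵥ b) ⬝ᵥ (X *ᵥ b)) := by
  have hstat : (X * Xᵀ - T) *ᵥ (X *ᵥ b) = 0 := by
    rw [mulVec_mulVec, Matrix.sub_mul, hX.mul_transpose_mul_eq hT, sub_self, zero_mulVec]
  have hform : u ⬝ᵥ (X * Xᵀ - T) *ᵥ u = -(u ⬝ᵥ T *ᵥ u) := by
    rw [sub_mulVec, ← mulVec_mulVec, hu, mulVec_zero, zero_sub, dotProduct_neg]
  set a := (u ⬝ᵥ T *ᵥ u) * (b ⬝ᵥ b) with ha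
  rcases le_or_gt a 0 with ha₀ | ha₀
  · exact ha₀.trans (mul_nonneg (real_dotProduct_self_nonneg u) (real_dotProduct_self_nonneg _))
  have huu : 0 < u ⬝ᵥ u := (real_dotProduct_self_nonneg u).lt_of_ne' fun h => by
    simp [dotProduct_self_eq_zero.1 h, ha] at ha₀
  -- minimizes `s ↦ s⁴ ‖u‖⁴ - 2 s² a`, the value of the update inequality at `q = s u`
  set s := √a / (u ⬝ᵥ u)
  have hs : s ^ 2 * (u ⬝ᵥ u) ^ 2 = a := by
    rw [← mul_pow, div_mul_cancel₀ _ huu.ne', Real.sq_sqrt ha₀.le]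
  have h := hX.rankOne_update_nonneg b (s • u)
  simp only [hstat, mulVec_smul, dotProduct_smul, smul_dotProduct, smul_eq_mul, hform,
    dotProduct_comm _ u, dotProduct_mulVec_eq_zero hu, dotProduct_zero, mul_zero] at h
  refine le_of_sq_le_sq ?_ (mul_nonneg huu.le (real_dotProduct_self_nonneg _))
  have hscaled := mul_nonneg (sq_nonneg (u ⬝ᵥ u)) h
  calc a ^ 2 = 2 * a * (s ^ 2 * (u ⬝ᵥ u) ^ 2) - (s ^ 2 * (u ⬝ᵥ u) ^ 2) ^ 2 := by rw [hs]; ring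
    _ ≤ ((u ⬝ᵥ u) * ((X *ᵥ b) ⬝ᵥ (X *ᵥ b))) ^ 2 := by rw [ha]; linarith

theorem IsBestFactor.rayleigh_mul_le_span {T : Matrix V V ℝ} (hT : T.IsSymm) {X : Matrix V κ ℝ}
    (hX : IsBestFactor T X) {u : V → ℝ} (hu : Xᵀ *ᵥ u = 0) (hτ : 0 ≤ u ⬝ᵥ T *ᵥ u)
    (b : κ → ℝ) (s : ℝ) :
    (u ⬝ᵥ T *ᵥ u) * ((X *ᵥ b + s • u) ⬝ᵥ (X *ᵥ b + s • u))
      ≤ (u ⬝ᵥ u) * ((X *ᵥ b + s • u) ⬝ᵥ T *ᵥ (X *ᵥ b + s • u)) := by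
  have huX := dotProduct_mulVec_eq_zero hu
  have hTb := hX.mulVec_mulVec_eq hT b
  have hb := hX.rayleigh_mul_le hT hu b
  set p := X *ᵥ b
  set q := Xᵀ *ᵥ p with hq
  have hup : u ⬝ᵥ p = 0 := huX b
  have hbq : b ⬝ᵥ q = p ⬝ᵥ p := by rw [hq, dotProduct_transpose_mulVec]
  have hpTp : p ⬝ᵥ T *ᵥ p = q ⬝ᵥ q := by rw [hTb, ← dotProduct_transpose_mulVec]
  have huTp : u ⬝ᵥ T *ᵥ p = 0 := by rw [hTb, huX]
  have hpTu : p ⬝ᵥ T *ᵥ u = 0 := by rw [← dotProduct_transpose_mulVec, hT.eq, huTp]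
  have hpp : (u ⬝ᵥ T *ᵥ u) * (p ⬝ᵥ p) ≤ (u ⬝ᵥ u) * (q ⬝ᵥ q) := by
    rcases (real_dotProduct_self_nonneg p).eq_or_lt with hp₀ | hp₀
    · rw [← hp₀, mul_zero]
      exact mul_nonneg (real_dotProduct_self_nonneg u) (real_dotProduct_self_nonneg q)
    refine le_of_mul_le_mul_right ?_ hp₀
    have hqq := real_dotProduct_self_nonneg q
    calc (u ⬝ᵥ T *ᵥ u) * (p ⬝ᵥ p) * (p ⬝ᵥ p) = (u ⬝ᵥ T *ᵥ u) * (b ⬝ᵥ q) ^ 2 := by rw [hbq]; ring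
      _ ≤ (u ⬝ᵥ T *ᵥ u) * ((b ⬝ᵥ b) * (q ⬝ᵥ q)) := by
        gcongr
        exact real_dotProduct_sq_le b q
      _ = (u ⬝ᵥ T *ᵥ u) * (b ⬝ᵥ b) * (q ⬝ᵥ q) := by ring
      _ ≤ (u ⬝ᵥ u) * (p ⬝ᵥ p) * (q ⬝ᵥ q) := by gcongr
      _ = (u ⬝ᵥ u) * (q ⬝ᵥ q) * (p ⬝ᵥ p) := by ring
  simp only [mulVec_add, mulVec_smul, add_dotProduct, dotProduct_add, smul_dotProduct,
    dotProduct_smul, smul_eq_mul, dotProduct_comm p u, hup, huTp, hpTu, hpTp]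
  linarith

theorem IsBestFactor.exists_span_mem_orthogonal {T : Matrix V V ℝ} (hT : T.IsSymm)
    {X : Matrix V κ ℝ} (hX : IsBestFactor T X) {ι : Type*} [Fintype ι] (w : ι → V → ℝ)
    (hι : Fintype.card ι ≤ Fintype.card κ) {u : V → ℝ} (hu : Xᵀ *ᵥ u = 0)
    (hτ : 0 < u ⬝ᵥ T *ᵥ u) :
    ∃ (b : κ → ℝ) (s : ℝ), X *ᵥ b + s • u ≠ 0 ∧ ∀ i, w i ⬝ᵥ (X *ᵥ b + s • u) = 0 := by
  let f : ((κ → ℝ) × ℝ) →ₗ[ℝ] (ι → ℝ) :=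
    (Matrix.of w).mulVecLin ∘ₗ (X.mulVecLin.coprod (LinearMap.toSpanSingleton ℝ (V → ℝ) u))
  have hker : LinearMap.ker f ≠ ⊥ := f.ker_ne_bot_of_finrank_lt (by simp; omega)
  obtain ⟨⟨b, s⟩, hmem, hne⟩ := (Submodule.ne_bot_iff _).1 hker
  refine ⟨b, s, fun hv => hne ?_, fun i => congrFun (LinearMap.mem_ker.1 hmem) i⟩
  have hu₀ : u ⬝ᵥ u ≠ 0 := fun h => by simp [dotProduct_self_eq_zero.1 h] at hτ
  have hs : s = 0 := by
    simpa [dotProduct_add, dotProduct_mulVec_eq_zero hu, hu₀] using congrArg (u ⬝ᵥ ·) hv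
  have hXb : X *ᵥ b = 0 := by simpa [hs] using hv
  have hb : b = 0 := by
    have hle := hX.rayleigh_mul_le hT hu b
    rw [hXb, dotProduct_zero, mul_zero] at hle
    exact dotProduct_self_eq_zero.1 (le_antisymm (nonpos_of_mul_nonpos_right hle hτ)
      (real_dotProduct_self_nonneg b))
  rw [hs, hb, Prod.mk_zero_zero]

/-- A min-max argument: the span of `u` and of the columns of `X` contains a nonzero vector
orthogonal to all the test vectors `w i`. -/
theorem IsBestFactor.rayleigh_le_of_forall {T : Matrix V V ℝ} (hT : T.IsSymm)
    {X : Matrix V κ ℝ} (hX : IsBestFactor T X) {ι : Type*} [Fintype ι] (w : ι → V → ℝ)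
    (hι : Fintype.card ι ≤ Fintype.card κ) {B : ℝ} (hB : 0 ≤ B)
    (h : ∀ v : V → ℝ, (∀ i, w i ⬝ᵥ v = 0) → v ⬝ᵥ T *ᵥ v ≤ B * (v ⬝ᵥ v))
    {u : V → ℝ} (hu : Xᵀ *ᵥ u = 0) : u ⬝ᵥ T *ᵥ u ≤ B * (u ⬝ᵥ u) := by
  have huu := real_dotProduct_self_nonneg u
  rcases le_or_gt (u ⬝ᵥ T *ᵥ u) 0 with hτ | hτ
  · exact hτ.trans (mul_nonneg hB huu)
  obtain ⟨b, s, hv₀, hv⟩ := hX.exists_span_mem_orthogonal hT w hι hu hτ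
  have hspan := hX.rayleigh_mul_le_span hT hu hτ.le b s
  set v := X *ᵥ b + s • u
  have hvv : 0 < v ⬝ᵥ v :=
    (real_dotProduct_self_nonneg v).lt_of_ne' (mt dotProduct_self_eq_zero.1 hv₀)
  refine le_of_mul_le_mul_right ?_ hvv
  calc (u ⬝ᵥ T *ᵥ u) * (v ⬝ᵥ v) ≤ (u ⬝ᵥ u) * (v ⬝ᵥ T *ᵥ v) := hspan
    _ ≤ (u ⬝ᵥ u) * (B * (v ⬝ᵥ v)) := by gcongr; exact h v hv
    _ = B * (u ⬝ᵥ u) * (v ⬝ᵥ v) := by ring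

theorem exists_transpose_mulVec_sub_eq_zero (X : Matrix V κ ℝ) (d : V → ℝ) :
    ∃ b, Xᵀ *ᵥ (d - X *ᵥ b) = 0 := by
  classical
  have hle : LinearMap.range (Xᵀ * X).mulVecLin ≤ LinearMap.range Xᵀ.mulVecLin := by
    rw [mulVecLin_mul]
    exact LinearMap.range_comp_le_range _ _
  have hrange : LinearMap.range (Xᵀ * X).mulVecLin = LinearMap.range Xᵀ.mulVecLin :=
    Submodule.eq_of_le_of_finrank_eq hle ((rank_transpose_mul_self X).trans (rank_transpose X).symm)
  obtain ⟨b, hb⟩ : Xᵀ *ᵥ d ∈ LinearMap.range (Xᵀ * X).mulVecLin := hrange ▸ ⟨d, rfl⟩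
  refine ⟨b, ?_⟩
  rw [mulVec_sub, mulVec_mulVec, sub_eq_zero]
  exact hb.symm

/-- The Davis–Kahan `sin θ` argument, applied to the residual `d - X b` of least squares. -/
theorem IsBestFactor.exists_sq_mul_residual_le {T : Matrix V V ℝ} (hT : T.IsSymm)
    {X : Matrix V κ ℝ} (hX : IsBestFactor T X) {ι : Type*} [Fintype ι] (w : ι → V → ℝ)
    (hι : Fintype.card ι ≤ Fintype.card κ) {B μ : ℝ} (hB : 0 ≤ B) (hμ : B ≤ μ)
    (h : ∀ v : V → ℝ, (∀ i, w i ⬝ᵥ v = 0) → v ⬝ᵥ T *ᵥ v ≤ B * (v ⬝ᵥ v))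
    {d e : V → ℝ} (hd : T *ᵥ d = μ • d + e) :
    ∃ b, (μ - B) ^ 2 * ((d - X *ᵥ b) ⬝ᵥ (d - X *ᵥ b)) ≤ e ⬝ᵥ e := by
  obtain ⟨b, hu⟩ := exists_transpose_mulVec_sub_eq_zero X d
  refine ⟨b, ?_⟩
  obtain ⟨u, rfl⟩ : ∃ u, d = X *ᵥ b + u := ⟨d - X *ᵥ b, by abel⟩
  rw [add_sub_cancel_left] at hu ⊢
  have huX := dotProduct_mulVec_eq_zero hu
  have hTu : u ⬝ᵥ T *ᵥ u = μ * (u ⬝ᵥ u) + u ⬝ᵥ e := by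
    simpa only [mulVec_add, dotProduct_add, dotProduct_smul, smul_eq_mul,
      hX.mulVec_mulVec_eq hT, huX, zero_add] using congrArg (u ⬝ᵥ ·) hd
  have hgap : (μ - B) * (u ⬝ᵥ u) ≤ -(u ⬝ᵥ e) := by
    linarith [hX.rayleigh_le_of_forall hT w hι hB h hu]
  have huu := real_dotProduct_self_nonneg u
  rcases huu.eq_or_lt with hu₀ | hu₀
  · simpa [← hu₀] using real_dotProduct_self_nonneg e
  refine le_of_mul_le_mul_right ?_ hu₀
  calc (μ - B) ^ 2 * (u ⬝ᵥ u) * (u ⬝ᵥ u) = ((μ - B) * (u ⬝ᵥ u)) ^ 2 := by ring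
    _ ≤ (-(u ⬝ᵥ e)) ^ 2 := by gcongr
    _ ≤ (u ⬝ᵥ u) * (e ⬝ᵥ e) := by rw [neg_sq]; exact real_dotProduct_sq_le u e
    _ = (e ⬝ᵥ e) * (u ⬝ᵥ u) := mul_comm _ _

end LowRank

section Pretraining

variable {V : Type}

theorem isSymm_adj (G : Graph V) : (adj G).IsSymm :=
  IsSymm.ext fun x y => by rw [adj, of_apply, of_apply, Sym2.eq_swap]

theorem adj_nonneg (G : Graph V) (x y : V) : 0 ≤ adj G x y := by
  rw [adj, of_apply]
  positivity

/-- The matrix whose rows are the features `φ x`. -/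
def featureMatrix {k : ℕ} (φ : V → EuclideanSpace ℝ (Fin k)) : Matrix V (Fin k) ℝ :=
  of fun x => (φ x).ofLp

theorem featureMatrix_mul_transpose_apply {k : ℕ} (φ : V → EuclideanSpace ℝ (Fin k)) (x y : V) :
    (featureMatrix φ * (featureMatrix φ)ᵀ) x y = ⟪φ x, φ y⟫ := by
  simp only [featureMatrix, mul_apply, transpose_apply, of_apply, PiLp.inner_apply,
    RCLike.inner_apply, conj_trivial, mul_comm]

variable [Fintype V]

theorem adj_eq_zero_of_sum_eq_zero {G : Graph V} (h : ∑ x, ∑ y, adj G x y = 0) : adj G = 0 := by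
  have hrow (x : V) : ∑ y, adj G x y = 0 :=
    (Fintype.sum_eq_zero_iff_of_nonneg fun x => Finset.sum_nonneg fun y _ => adj_nonneg G x y).1 h
      |> (congrFun · x)
  ext x y
  exact congrFun ((Fintype.sum_eq_zero_iff_of_nonneg (adj_nonneg G x)).1 (hrow x)) y

theorem card_sq_mul_pretrainLoss [Nonempty V] {k : ℕ} (G : Graph V)
    (φ : V → EuclideanSpace ℝ (Fin k)) :
    (Fintype.card V : ℝ) ^ 2 * pretrainLoss G φ =
      frobSq (featureMatrix φ * (featureMatrix φ)ᵀ
        - ((Fintype.card V : ℝ) ^ 2 / ∑ u, ∑ u', adj G u u') • adj G)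
      - frobSq (((Fintype.card V : ℝ) ^ 2 / ∑ u, ∑ u', adj G u u') • adj G) := by
  have hN : (Fintype.card V : ℝ) ≠ 0 := by exact_mod_cast Fintype.card_ne_zero
  simp only [pretrainLoss, frobSq_eq_sum, Finset.mul_sum, mul_add, ← Finset.sum_add_distrib,
    ← Finset.sum_sub_distrib, Matrix.sub_apply, Matrix.smul_apply, smul_eq_mul,
    featureMatrix_mul_transpose_apply]
  refine Finset.sum_congr rfl fun x _ => Finset.sum_congr rfl fun y _ => ?_
  field_simp
  ring

theorem IsPretrained.isBestFactor {k : ℕ} {G : Graph V} {φ : V → EuclideanSpace ℝ (Fin k)}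
    (hφ : IsPretrained G φ) :
    IsBestFactor (((Fintype.card V : ℝ) ^ 2 / ∑ u, ∑ u', adj G u u') • adj G)
      (featureMatrix φ) := by
  intro Y
  rcases isEmpty_or_nonempty V with hV | hV
  · simp [frobSq_eq_sum]
  have h := mul_le_mul_of_nonneg_left (hφ fun x => WithLp.toLp 2 (Y x))
    (sq_nonneg (Fintype.card V : ℝ))
  rw [card_sq_mul_pretrainLoss, card_sq_mul_pretrainLoss] at h
  exact (sub_le_sub_iff_right _).1 h

theorem IsPretrained.exists_isBestFactor_adj {k : ℕ} {G : Graph V}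
    {φ : V → EuclideanSpace ℝ (Fin k)} (hφ : IsPretrained G φ) :
    ∃ a : ℝ, IsBestFactor (adj G) (a • featureMatrix φ) := by
  have hX := hφ.isBestFactor
  rcases isEmpty_or_nonempty V with hV | hV
  · exact ⟨1, fun Y => by simp [frobSq_eq_sum]⟩
  by_cases hS : ∑ u, ∑ u', adj G u u' = 0
  · rw [adj_eq_zero_of_sum_eq_zero hS, smul_zero] at hX
    exact ⟨1, by rwa [adj_eq_zero_of_sum_eq_zero hS, one_smul]⟩
  · have hS₀ : 0 ≤ ∑ u, ∑ u', adj G u u' :=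
      Finset.sum_nonneg fun u _ => Finset.sum_nonneg fun u' _ => adj_nonneg G u u'
    exact ⟨_, hX.of_smul (by positivity)⟩

end Pretraining

section BlockModel

variable {V : Type}

/-- The expected adjacency matrix when the edge `e` is present with probability `p e`. -/
def meanAdj (p : Sym2 V → I) : Matrix V V ℝ :=
  of fun x y => (p s(x, y) : ℝ)

/-- The deviation of the adjacency matrix of `G` from its mean. -/
def noiseMatrix (p : Sym2 V → I) (G : Graph V) : Matrix V V ℝ :=
  adj G - meanAdj p

theorem isSymm_meanAdj (p : Sym2 V → I) : (meanAdj p).IsSymm :=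
  IsSymm.ext fun x y => by rw [meanAdj, of_apply, of_apply, Sym2.eq_swap]

theorem isSymm_noiseMatrix (p : Sym2 V → I) (G : Graph V) : (noiseMatrix p G).IsSymm :=
  (isSymm_adj G).sub (isSymm_meanAdj p)

variable {r n : ℕ} {ρ α β γ : I}

/-- The sum of `v` over the nodes of domain `d` and class `y`. -/
def blockSum (v : Node r n → ℝ) (d : Fin 2) (y : Fin r) : ℝ :=
  ∑ i, v (d, y, i)

theorem sum_mul_eq_sum_mul_blockSum (f : Fin 2 → Fin r → ℝ) (v : Node r n → ℝ) :
    ∑ x, f (dom x) (cls x) * v x = ∑ d, ∑ y, f d y * blockSum v d y := by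
  simp only [Fintype.sum_prod_type, dom, cls, blockSum, Finset.mul_sum]

theorem meanAdj_edgeProb_mulVec (v : Node r n → ℝ) (x : Node r n) :
    (meanAdj (edgeProb ρ α β γ) *ᵥ v) x = γ * ∑ d, ∑ y, blockSum v d y
      + (α - γ) * ∑ d, blockSum v d (cls x) + (β - γ) * ∑ y, blockSum v (dom x) y
      + (ρ - α - β + γ) * blockSum v (dom x) (cls x) := by
  let f (d : Fin 2) (y : Fin r) : ℝ := γ + (α - γ) * (if cls x = y then 1 else 0)
    + (β - γ) * (if dom x = d then 1 else 0)
    + (ρ - α - β + γ) * ((if dom x = d then 1 else 0) * (if cls x = y then 1 else 0))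
  have hentry (x' : Node r n) : meanAdj (edgeProb ρ α β γ) x x' = f (dom x') (cls x') := by
    simp only [meanAdj, of_apply, edgeProb, Sym2.lift_mk, f]
    split_ifs <;> ring
  simp only [mulVec, dotProduct, hentry, sum_mul_eq_sum_mul_blockSum]
  simp only [f, add_mul, mul_assoc, Finset.sum_add_distrib, ← Finset.mul_sum]
  simp only [ite_mul, one_mul, zero_mul, Finset.sum_ite_eq, Finset.mem_univ, if_true]

/-- The vector that is `1` on domain `0` and `-1` on domain `1`. -/
def domSign (x : Node r n) : ℝ := ![1, -1] (dom x)

theorem domSign_sq (x : Node r n) : domSign x ^ 2 = 1 := by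
  unfold domSign
  generalize dom x = d
  fin_cases d <;> simp

theorem blockSum_domSign (d : Fin 2) (y : Fin r) :
    blockSum (domSign : Node r n → ℝ) d y = n * ![1, -1] d := by
  simp only [blockSum, domSign, dom, Finset.sum_const, Finset.card_univ, Fintype.card_fin,
    nsmul_eq_mul]

theorem meanAdj_edgeProb_mulVec_domSign :
    meanAdj (edgeProb ρ α β γ) *ᵥ (domSign : Node r n → ℝ)
      = (n * (r * (β - γ) + (ρ - α - β + γ)) : ℝ) • domSign := by
  ext x
  simp only [meanAdj_edgeProb_mulVec, blockSum_domSign, Fin.sum_univ_two, Finset.sum_const,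
    Finset.card_univ, Fintype.card_fin, nsmul_eq_mul, Pi.smul_apply, smul_eq_mul, domSign,
    cons_val_zero, cons_val_one]
  ring

/-- The test vectors of the min-max argument: the signs of the domains, and the indicators of the
classes. -/
def testVector : Option (Fin r) → Node r n → ℝ
  | none => domSign
  | some y => fun x => if cls x = y then 1 else 0

theorem meanAdj_edgeProb_mulVec_of_orthogonal {v : Node r n → ℝ}
    (hv : ∀ i, testVector i ⬝ᵥ v = 0) (x : Node r n) :
    (meanAdj (edgeProb ρ α β γ) *ᵥ v) x = (ρ - α - β + γ) * blockSum v (dom x) (cls x) := by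
  have hcls (y : Fin r) : blockSum v 0 y + blockSum v 1 y = 0 := by
    simpa using (sum_mul_eq_sum_mul_blockSum (fun _ y' => if y' = y then 1 else 0) v).symm.trans
      (hv (some y))
  have hdiff : ∑ y, blockSum v 0 y - ∑ y, blockSum v 1 y = 0 := by
    simpa [← sub_eq_add_neg] using
      (sum_mul_eq_sum_mul_blockSum (fun d _ => ![1, -1] d) v).symm.trans (hv none)
  have hsum : ∑ y, blockSum v 0 y + ∑ y, blockSum v 1 y = 0 := by
    rw [← Finset.sum_add_distrib]
    exact Finset.sum_eq_zero fun y _ => hcls y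
  have hdom (d : Fin 2) : ∑ y, blockSum v d y = 0 := by
    fin_cases d <;> simp <;> linarith
  simp only [meanAdj_edgeProb_mulVec, hdom, Fin.sum_univ_two (f := fun d => blockSum v d (cls x)),
    hcls, Finset.sum_const_zero, mul_zero, add_zero, zero_add]

theorem meanAdj_edgeProb_rayleigh_le {v : Node r n → ℝ} (hv : ∀ i, testVector i ⬝ᵥ v = 0) :
    v ⬝ᵥ meanAdj (edgeProb ρ α β γ) *ᵥ v
      ≤ n * max ((ρ : ℝ) - α - β + γ) 0 * (v ⬝ᵥ v) := by
  have hblock : ∑ d, ∑ y, blockSum v d y ^ 2 ≤ n * (v ⬝ᵥ v) := by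
    simp only [dotProduct, Fintype.sum_prod_type, Finset.mul_sum, ← sq]
    refine Finset.sum_le_sum fun d _ => Finset.sum_le_sum fun y _ => ?_
    simpa [blockSum, Finset.mul_sum] using
      sq_sum_le_card_mul_sum_sq (s := Finset.univ) (f := fun i => v (d, y, i))
  calc v ⬝ᵥ meanAdj (edgeProb ρ α β γ) *ᵥ v
      = (ρ - α - β + γ) * ∑ d, ∑ y, blockSum v d y ^ 2 := by
        simp only [dotProduct, meanAdj_edgeProb_mulVec_of_orthogonal hv, Fintype.sum_prod_type,
          dom, cls, Finset.mul_sum]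
        refine Finset.sum_congr rfl fun d _ => Finset.sum_congr rfl fun y _ => ?_
        rw [← Finset.sum_mul, sq, blockSum]
        ring
    _ ≤ max ((ρ : ℝ) - α - β + γ) 0 * ∑ d, ∑ y, blockSum v d y ^ 2 := by
        gcongr
        exact le_max_left _ _
    _ ≤ max ((ρ : ℝ) - α - β + γ) 0 * (n * (v ⬝ᵥ v)) := by gcongr
    _ = n * max ((ρ : ℝ) - α - β + γ) 0 * (v ⬝ᵥ v) := by ring

theorem spectral_gap_domSign (hr : 2 ≤ r) (hαρ : α ≤ ρ) (hγβ : γ ≤ β) :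
    n * max ((ρ : ℝ) - α - β + γ) 0 + n * r * (β - γ) / 2
      ≤ n * (r * (β - γ) + (ρ - α - β + γ)) := by
  have hr' : (2 : ℝ) ≤ r := by exact_mod_cast hr
  have hαρ' : (α : ℝ) ≤ ρ := hαρ
  have hb : 0 ≤ (β : ℝ) - γ := sub_nonneg.2 hγβ
  have hrb : 2 * ((β : ℝ) - γ) ≤ r * (β - γ) := by gcongr
  have hmax : max ((ρ : ℝ) - α - β + γ) 0 + r * (β - γ) / 2
      ≤ r * (β - γ) + (ρ - α - β + γ) := by
    rw [← le_sub_iff_add_le]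
    exact max_le (by linarith) (by linarith)
  calc n * max ((ρ : ℝ) - α - β + γ) 0 + n * r * (β - γ) / 2
      = n * (max ((ρ : ℝ) - α - β + γ) 0 + r * (β - γ) / 2) := by ring
    _ ≤ n * (r * (β - γ) + (ρ - α - β + γ)) := by gcongr

theorem exists_linearClassifier_card_mul_loss_le {k : ℕ}
    (φ : Node r n → EuclideanSpace ℝ (Fin k)) (b : Fin k → ℝ) :
    ∃ h : EuclideanSpace ℝ (Fin k) → Fin 2, IsLinearClassifier h ∧
      domainZeroOneLoss h φ * Fintype.card (Node r n) ≤
        (domSign - featureMatrix φ *ᵥ b) ⬝ᵥ (domSign - featureMatrix φ *ᵥ b) := by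
  refine ⟨linearClassifier (of ![b, 0]), ⟨_, rfl⟩, ?_⟩
  rw [domainZeroOneLoss, Finset.sum_mul]
  refine Finset.sum_le_sum fun x _ => ?_
  have hcard : (Fintype.card (Node r n) : ℝ) ≠ 0 :=
    Nat.cast_ne_zero.2 (Fintype.card_pos_iff.2 ⟨x⟩).ne'
  rw [mul_right_comm, one_div_mul_cancel hcard, one_mul]
  have hscore₀ : (of ![b, 0] *ᵥ (φ x).ofLp) 0 = (featureMatrix φ *ᵥ b) x := dotProduct_comm _ _
  have hscore₁ : (of ![b, 0] *ᵥ (φ x).ofLp) 1 = 0 := zero_dotProduct _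
  rw [linearClassifier, hscore₀, hscore₁, Pi.sub_apply, domSign]
  generalize dom x = d
  -- a misclassified node has a score of the wrong sign
  split_ifs with hscore hne hne
  all_goals
    fin_cases d
    all_goals simp at hne ⊢
    all_goals nlinarith

theorem IsPretrained.exists_linearClassifier_sq_mul_loss_le {k : ℕ} (hr : 2 ≤ r) (hk : r < k)
    (hαρ : α ≤ ρ) (hγβ : γ ≤ β) {G : Graph (Node r n)} {η : ℝ} (hη₀ : 0 ≤ η)
    (hη : η ≤ n * r * (β - γ) / 4)
    (hE : frobSq (noiseMatrix (edgeProb ρ α β γ) G * noiseMatrix (edgeProb ρ α β γ) G) ≤ η ^ 4)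
    {φ : Node r n → EuclideanSpace ℝ (Fin k)} (hφ : IsPretrained G φ) :
    ∃ h : EuclideanSpace ℝ (Fin k) → Fin 2, IsLinearClassifier h ∧
      η ^ 2 * (domainZeroOneLoss h φ * Fintype.card (Node r n)) ≤
        (noiseMatrix (edgeProb ρ α β γ) G *ᵥ domSign)
          ⬝ᵥ (noiseMatrix (edgeProb ρ α β γ) G *ᵥ domSign) := by
  obtain ⟨a, hX⟩ := hφ.exists_isBestFactor_adj
  have hadj : adj G = meanAdj (edgeProb ρ α β γ) + noiseMatrix (edgeProb ρ α β γ) G :=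
    (add_sub_cancel _ _).symm
  have hrayleigh (v : Node r n → ℝ) (hv : ∀ i, testVector i ⬝ᵥ v = 0) :
      v ⬝ᵥ adj G *ᵥ v ≤ (n * max ((ρ : ℝ) - α - β + γ) 0 + η) * (v ⬝ᵥ v) := by
    rw [hadj, add_mulVec, dotProduct_add, add_mul]
    exact add_le_add (meanAdj_edgeProb_rayleigh_le hv)
      (dotProduct_mulVec_le_of_frobSq_mul_self_le (isSymm_noiseMatrix _ G) hη₀ hE v)
  have hgap : η ≤ n * (r * (β - γ) + (ρ - α - β + γ))
      - (n * max ((ρ : ℝ) - α - β + γ) 0 + η) := by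
    linarith [spectral_gap_domSign (n := n) hr hαρ hγβ]
  have hdomSign : adj G *ᵥ domSign = (n * (r * (β - γ) + (ρ - α - β + γ)) : ℝ) • domSign
      + noiseMatrix (edgeProb ρ α β γ) G *ᵥ domSign := by
    rw [← meanAdj_edgeProb_mulVec_domSign, ← add_mulVec, ← hadj]
  obtain ⟨b, hb⟩ := hX.exists_sq_mul_residual_le (isSymm_adj G) testVector (by simpa using hk)
    (by positivity) (by linarith) hrayleigh hdomSign
  obtain ⟨h, hlin, hloss⟩ := exists_linearClassifier_card_mul_loss_le φ (a • b)
  rw [mulVec_smul, ← smul_mulVec] at hloss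
  refine ⟨h, hlin, (mul_le_mul_of_nonneg_left hloss (sq_nonneg η)).trans (le_trans ?_ hb)⟩
  gcongr
  exact real_dotProduct_self_nonneg _

end BlockModel

section Noise

variable {ι : Type*}

/-- The centered indicator of the event that the edge `e` is present. -/
def noise (p : ι → I) (e : ι) (G : ι → Bool) : ℝ := (if G e then 1 else 0) - p e

theorem abs_noise_le_one (p : ι → I) (e : ι) (G : ι → Bool) : |noise p e G| ≤ 1 := by
  have h₀ := (p e).2.1
  have h₁ := (p e).2.2
  rw [noise, abs_le]
  split_ifs <;> constructor <;> linarith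

theorem abs_prod_noise_le_one (p : ι → I) (s : Multiset ι) (G : ι → Bool) :
    |(s.map (noise p · G)).prod| ≤ 1 := by
  induction s using Multiset.induction_on with
  | empty => simp
  | cons e s ih =>
    rw [Multiset.map_cons, Multiset.prod_cons, abs_mul]
    exact mul_le_one₀ (abs_noise_le_one p e G) (abs_nonneg _) ih

variable [Fintype ι]

/-- The law of a random subset of `ι` which contains each `e` independently with probability
`p e`. The stochastic block model is an instance. -/
noncomputable abbrev edgeLaw (p : ι → I) : Measure (ι → Bool) :=
  Measure.pi fun e => bernoulliMeasure true false (p e)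

theorem integral_prod_noise_le_one (p : ι → I) (s : Multiset ι) :
    ∫ G, (s.map (noise p · G)).prod ∂edgeLaw p ≤ 1 := by
  simpa using integral_mono (μ := edgeLaw p) Integrable.of_finite (integrable_const (1 : ℝ))
    fun G => (le_abs_self _).trans (abs_prod_noise_le_one p s G)

theorem integral_prod_noise_eq_zero [DecidableEq ι] (p : ι → I) {s : Multiset ι} {e : ι}
    (he : s.count e = 1) : ∫ G, (s.map (noise p · G)).prod ∂edgeLaw p = 0 := by
  let f (i : ι) (b : Bool) : ℝ := ((if b then 1 else 0) - p i) ^ s.count i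
  have hprod (G : ι → Bool) : (s.map (noise p · G)).prod = ∏ i, f i (G i) := by
    rw [Finset.prod_multiset_map_count]
    refine Finset.prod_subset (Finset.subset_univ _) fun i _ hi => ?_
    rw [Multiset.count_eq_zero.2 (by simpa using hi), pow_zero]
  simp only [hprod, integral_fintype_prod_eq_prod (E := fun _ => Bool) f]
  refine Finset.prod_eq_zero (Finset.mem_univ e) ?_
  simp only [f, he, integral_bernoulliMeasure]
  simp
  ring

end Noise

section NoiseMatrix

variable {V : Type}

theorem noiseMatrix_apply (p : Sym2 V → I) (G : Graph V) (x y : V) :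
    noiseMatrix p G x y = noise p s(x, y) G := rfl

theorem exists_count_fourCycle_eq_one [DecidableEq V] {x y z w : V} (hxy : x ≠ y) (hzw : z ≠ w) :
    ∃ e, Multiset.count e {s(x, z), s(z, y), s(x, w), s(w, y)} = 1 := by
  by_cases hc : x = w ∧ z = y
  · obtain ⟨rfl, rfl⟩ := hc
    exact ⟨s(z, z), by simp [Multiset.insert_eq_cons, hxy, hxy.symm]⟩
  · have h₁ : s(x, z) ≠ s(z, y) := by rw [Ne, Sym2.eq_iff]; grind
    have h₂ : s(x, z) ≠ s(x, w) := by rw [Ne, Sym2.eq_iff]; grind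
    have h₃ : s(x, z) ≠ s(w, y) := by rw [Ne, Sym2.eq_iff]; grind
    exact ⟨s(x, z), by simp [Multiset.insert_eq_cons, h₁, h₂, h₃]⟩

variable [Fintype V]

theorem integral_noise_mul_noise_le [DecidableEq V] (p : Sym2 V → I) (d : V → ℝ) (x y z : V) :
    ∫ G, d y * d z * (noise p s(x, y) G * noise p s(x, z) G) ∂edgeLaw p
      ≤ if y = z then d y * d z else 0 := by
  have hpair (G : Graph V) : noise p s(x, y) G * noise p s(x, z) G
      = (({s(x, y), s(x, z)} : Multiset (Sym2 V)).map (noise p · G)).prod := by simp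
  simp only [integral_const_mul, hpair]
  split_ifs with hyz
  · subst hyz
    exact mul_le_of_le_one_right (mul_self_nonneg _) (integral_prod_noise_le_one p _)
  · have hcount : Multiset.count s(x, y) {s(x, y), s(x, z)} = 1 := by
      have : s(x, y) ≠ s(x, z) := by rw [Ne, Sym2.eq_iff]; grind
      simp [this]
    rw [integral_prod_noise_eq_zero p hcount, mul_zero]

theorem integral_noise_fourCycle_le [DecidableEq V] (p : Sym2 V → I) (x y z w : V) :
    ∫ G, noise p s(x, z) G * (noise p s(z, y) G * (noise p s(x, w) G * noise p s(w, y) G))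
      ∂edgeLaw p ≤ (if x = y then 1 else 0) + (if z = w then 1 else 0) := by
  have hcycle (G : Graph V) :
      noise p s(x, z) G * (noise p s(z, y) G * (noise p s(x, w) G * noise p s(w, y) G))
      = (({s(x, z), s(z, y), s(x, w), s(w, y)} : Multiset (Sym2 V)).map (noise p · G)).prod := by
    simp
  simp only [hcycle]
  by_cases h : x = y ∨ z = w
  · refine (integral_prod_noise_le_one p _).trans ?_
    rcases h with h | h <;> rw [if_pos h] <;> split_ifs <;> norm_num
  · push Not at h
    obtain ⟨e, he⟩ := exists_count_fourCycle_eq_one h.1 h.2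
    rw [integral_prod_noise_eq_zero p he]
    positivity

theorem integral_noiseMatrix_mulVec_le (p : Sym2 V → I) (d : V → ℝ) :
    ∫ G, (noiseMatrix p G *ᵥ d) ⬝ᵥ (noiseMatrix p G *ᵥ d) ∂edgeLaw p
      ≤ Fintype.card V * (d ⬝ᵥ d) := by
  classical
  have hexpand (G : Graph V) : (noiseMatrix p G *ᵥ d) ⬝ᵥ (noiseMatrix p G *ᵥ d)
      = ∑ x, ∑ y, ∑ z, d y * d z * (noise p s(x, y) G * noise p s(x, z) G) := by
    simp only [dotProduct, mulVec, noiseMatrix_apply, Finset.sum_mul_sum]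
    refine Finset.sum_congr rfl fun x _ => Finset.sum_congr rfl fun y _ =>
      Finset.sum_congr rfl fun z _ => ?_
    ring
  simp only [hexpand, integral_finsetSum _ fun _ _ => Integrable.of_finite]
  calc _ ≤ ∑ _x : V, ∑ y, ∑ z, if y = z then d y * d z else 0 :=
        Finset.sum_le_sum fun x _ => Finset.sum_le_sum fun y _ => Finset.sum_le_sum fun z _ =>
          integral_noise_mul_noise_le p d x y z
    _ = Fintype.card V * (d ⬝ᵥ d) := by simp [dotProduct]

theorem integral_frobSq_noiseMatrix_mul_self_le (p : Sym2 V → I) :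
    ∫ G, frobSq (noiseMatrix p G * noiseMatrix p G) ∂edgeLaw p
      ≤ 2 * (Fintype.card V : ℝ) ^ 3 := by
  classical
  have hexpand (G : Graph V) : frobSq (noiseMatrix p G * noiseMatrix p G)
      = ∑ x, ∑ y, ∑ z, ∑ w, noise p s(x, z) G * (noise p s(z, y) G *
          (noise p s(x, w) G * noise p s(w, y) G)) := by
    simp only [frobSq_eq_sum, mul_apply, noiseMatrix_apply, sq, Finset.sum_mul_sum, mul_assoc]
  simp only [hexpand, integral_finsetSum _ fun _ _ => Integrable.of_finite]
  calc _ ≤ ∑ x : V, ∑ y : V, ∑ z : V, ∑ w : V,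
          ((if x = y then 1 else 0) + (if z = w then 1 else 0) : ℝ) :=
        Finset.sum_le_sum fun x _ => Finset.sum_le_sum fun y _ => Finset.sum_le_sum fun z _ =>
          Finset.sum_le_sum fun w _ => integral_noise_fourCycle_le p x y z w
    _ = 2 * (Fintype.card V : ℝ) ^ 3 := by
        simp [Finset.sum_add_distrib]
        ring

theorem one_sub_integral_le_measureReal_lt_one {Ω : Type*} {_ : MeasurableSpace Ω}
    {μ : Measure Ω} [IsProbabilityMeasure μ] {f : Ω → ℝ} (hf₀ : 0 ≤ᵐ[μ] f)
    (hf : Integrable f μ) : 1 - ∫ ω, f ω ∂μ ≤ μ.real {ω | f ω < 1} := by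
  have hmarkov := mul_meas_ge_le_integral_of_nonneg hf₀ hf 1
  have hmeas : NullMeasurableSet {ω | 1 ≤ f ω} μ :=
    nullMeasurableSet_le aemeasurable_const hf.1.aemeasurable
  have hcompl : {ω | f ω < 1} = {ω | 1 ≤ f ω}ᶜ := by
    ext ω
    exact (not_le (a := (1 : ℝ))).symm
  rw [hcompl, probReal_compl_eq_one_sub₀ hmeas]
  linarith

theorem one_sub_le_edgeLaw_real_noise_le [Nonempty V] (p : Sym2 V → I) {d : V → ℝ}
    (hd : ∀ x, d x ^ 2 = 1) {δ : ℝ} (hδ : 0 < δ) :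
    1 - δ ≤ (edgeLaw p).real {G |
      (noiseMatrix p G *ᵥ d) ⬝ᵥ (noiseMatrix p G *ᵥ d) ≤ 3 / δ * (Fintype.card V : ℝ) ^ 2 ∧
      frobSq (noiseMatrix p G * noiseMatrix p G) ≤ 3 / δ * (Fintype.card V : ℝ) ^ 3} := by
  have hN : 0 < (Fintype.card V : ℝ) := Nat.cast_pos.2 Fintype.card_pos
  set N : ℝ := (Fintype.card V : ℝ)
  let f (G : Graph V) : ℝ := (noiseMatrix p G *ᵥ d) ⬝ᵥ (noiseMatrix p G *ᵥ d) / (3 / δ * N ^ 2)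
  let g (G : Graph V) : ℝ := frobSq (noiseMatrix p G * noiseMatrix p G) / (3 / δ * N ^ 3)
  have hf₀ (G : Graph V) : 0 ≤ f G := div_nonneg (real_dotProduct_self_nonneg _) (by positivity)
  have hg₀ (G : Graph V) : 0 ≤ g G := div_nonneg (frobSq_nonneg _) (by positivity)
  have hf : ∫ G, f G ∂edgeLaw p ≤ δ / 3 := by
    have hdd : d ⬝ᵥ d = N := by simp [dotProduct, ← sq, hd, N]
    rw [integral_div, div_le_iff₀ (by positivity)]
    calc _ ≤ N * (d ⬝ᵥ d) := integral_noiseMatrix_mulVec_le p d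
      _ = δ / 3 * (3 / δ * N ^ 2) := by rw [hdd]; field_simp
  have hg : ∫ G, g G ∂edgeLaw p ≤ 2 * δ / 3 := by
    rw [integral_div, div_le_iff₀ (by positivity)]
    calc _ ≤ 2 * N ^ 3 := integral_frobSq_noiseMatrix_mul_self_le p
      _ = 2 * δ / 3 * (3 / δ * N ^ 3) := by field_simp
  have hmarkov := one_sub_integral_le_measureReal_lt_one (μ := edgeLaw p) (f := fun G => f G + g G)
    (ae_of_all _ fun G => add_nonneg (hf₀ G) (hg₀ G)) Integrable.of_finite
  rw [integral_add Integrable.of_finite Integrable.of_finite] at hmarkov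
  calc 1 - δ ≤ (edgeLaw p).real {G | f G + g G < 1} := by linarith
    _ ≤ _ := measureReal_mono fun G hG => by
      have hG' : f G + g G < 1 := hG
      exact ⟨(div_le_one (by positivity)).1 (by linarith [hg₀ G] : f G ≤ 1),
        (div_le_one (by positivity)).1 (by linarith [hf₀ G] : g G ≤ 1)⟩

end NoiseMatrix

section Probability

variable {r n k : ℕ} {ρ α β γ : I}

theorem card_node : (Fintype.card (Node r n) : ℝ) = 2 * r * n := by
  simp [mul_assoc]

theorem domainZeroOneLoss_le_one (h : EuclideanSpace ℝ (Fin k) → Fin 2)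
    (φ : Node r n → EuclideanSpace ℝ (Fin k)) : domainZeroOneLoss h φ ≤ 1 := by
  calc domainZeroOneLoss h φ ≤ ∑ _x : Node r n, 1 / (Fintype.card (Node r n) : ℝ) :=
        Finset.sum_le_sum fun x _ => mul_le_of_le_one_right (by positivity) (by split_ifs <;> simp)
    _ = Fintype.card (Node r n) * (1 / (Fintype.card (Node r n) : ℝ)) := by
        rw [Finset.sum_const, Finset.card_univ, nsmul_eq_mul]
    _ ≤ 1 := by
        rw [mul_one_div]
        exact div_self_le_one _

theorem IsPretrained.exists_linearClassifier_loss_le_of_noise_le (hr : 2 ≤ r) (hn : 0 < n)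
    (hk : r < k) (hαρ : α ≤ ρ) (hγβ : γ < β) {G : Graph (Node r n)} {K : ℝ}
    (hdomSign : (noiseMatrix (edgeProb ρ α β γ) G *ᵥ domSign)
      ⬝ᵥ (noiseMatrix (edgeProb ρ α β γ) G *ᵥ domSign) ≤ K * (Fintype.card (Node r n) : ℝ) ^ 2)
    (hfrob : frobSq (noiseMatrix (edgeProb ρ α β γ) G * noiseMatrix (edgeProb ρ α β γ) G)
      ≤ K * (Fintype.card (Node r n) : ℝ) ^ 3)
    {φ : Node r n → EuclideanSpace ℝ (Fin k)} (hφ : IsPretrained G φ) :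
    ∃ h : EuclideanSpace ℝ (Fin k) → Fin 2, IsLinearClassifier h ∧
      domainZeroOneLoss h φ ≤ 2048 * K / (r * ((β : ℝ) - γ) ^ 4 * n) := by
  have hn' : (0 : ℝ) < n := Nat.cast_pos.2 hn
  have hr' : (0 : ℝ) < r := Nat.cast_pos.2 (by omega)
  have hb₀ : 0 < (β : ℝ) - γ := sub_pos.2 hγβ
  have hb₁ : (β : ℝ) - γ ≤ 1 := by linarith [β.2.2, γ.2.1]
  rw [card_node] at hdomSign hfrob
  set b : ℝ := (β : ℝ) - γ
  rcases le_or_gt (2048 * K) (r * b ^ 4 * n) with hK | hK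
  · have hη : K * (2 * r * n) ^ 3 ≤ (n * r * b / 4) ^ 4 := calc
      K * (2 * r * n) ^ 3 = 2048 * K * (r * n) ^ 3 / 256 := by ring
      _ ≤ r * b ^ 4 * n * (r * n) ^ 3 / 256 := by gcongr
      _ = (n * r * b / 4) ^ 4 := by ring
    obtain ⟨h, hlin, hloss⟩ := hφ.exists_linearClassifier_sq_mul_loss_le hr hk hαρ hγβ.le
      (by positivity) le_rfl (hfrob.trans hη)
    refine ⟨h, hlin, ?_⟩
    have hK₀ : 0 ≤ K :=
      nonneg_of_mul_nonneg_left ((frobSq_nonneg _).trans hfrob) (by positivity)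
    rw [card_node] at hloss
    have hloss' : domainZeroOneLoss h φ * (r * b ^ 2 * n) ≤ 32 * K :=
      le_of_mul_le_mul_right (a := (r * n : ℝ) ^ 2) (by linarith) (by positivity)
    rw [le_div_iff₀ (by positivity)]
    calc domainZeroOneLoss h φ * (r * b ^ 4 * n)
        = b ^ 2 * (domainZeroOneLoss h φ * (r * b ^ 2 * n)) := by ring
      _ ≤ b ^ 2 * (32 * K) := by gcongr
      _ ≤ 1 * (32 * K) := by gcongr; exact pow_le_one₀ hb₀.le hb₁
      _ ≤ 2048 * K := by linarith
  · exact ⟨linearClassifier 0, ⟨0, rfl⟩, (domainZeroOneLoss_le_one _ φ).trans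
      ((one_le_div₀ (by positivity)).2 hK.le)⟩

end Probability

end ContrastiveSBM

theorem mainTheorem2_general {r n k : ℕ} {ρ α β γ : unitInterval} (hr : 2 ≤ r) (hn : 0 < n)
    (hk : r < k) (hαρ : α ≤ ρ) (hγβ : γ < β) {δ : ℝ} (hδ : 0 < δ) :
    1 - δ ≤ (ContrastiveSBM.sbm r n ρ α β γ).real
      {G | ∀ φ : ContrastiveSBM.Node r n → EuclideanSpace ℝ (Fin k),
        ContrastiveSBM.IsPretrained G φ →
        ∃ h : EuclideanSpace ℝ (Fin k) → Fin 2,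
          ContrastiveSBM.IsLinearClassifier h ∧
          ContrastiveSBM.domainZeroOneLoss h φ ≤ 6144 / (δ * r * ((β : ℝ) - γ) ^ 4 * n)} := by
  have : Nonempty (ContrastiveSBM.Node r n) := ⟨0, ⟨0, by omega⟩, ⟨0, hn⟩⟩
  refine (ContrastiveSBM.one_sub_le_edgeLaw_real_noise_le (ContrastiveSBM.edgeProb ρ α β γ)
    ContrastiveSBM.domSign_sq hδ).trans (measureReal_mono fun G hG φ hφ => ?_)
  obtain ⟨h, hlin, hloss⟩ :=
    hφ.exists_linearClassifier_loss_le_of_noise_le hr hn hk hαρ hγβ hG.1 hG.2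
  refine ⟨h, hlin, hloss.trans_eq ?_⟩
  rw [← mul_div_assoc, div_div]
  ring

theorem mainTheorem2 :
    ∃ c > (0 : ℝ), ∃ C > (0 : ℝ), ∃ p : Polynomial ℝ,
      ∀ (r n : ℕ) (ρ α β γ : unitInterval),
        2 ≤ r → max α β < ρ → γ < min α β →
        c * ((r : ℝ) / min ((α : ℝ) - γ) ((β : ℝ) - γ) ^ 2) ≤ (n : ℝ) →
        0.999 ≤ (ContrastiveSBM.sbm r n ρ α β γ).real
          {G | ∀ φ : ContrastiveSBM.Node r n → EuclideanSpace ℝ (Fin (r + 1)),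
            ContrastiveSBM.IsPretrained G φ →
            ∃ h : EuclideanSpace ℝ (Fin (r + 1)) → Fin 2,
              ContrastiveSBM.IsLinearClassifier h ∧
              ContrastiveSBM.domainZeroOneLoss h φ ≤
                C * (1 / (min ((α : ℝ) - γ) ((β : ℝ) - γ) ^ 6 * (n : ℝ))) *
                  p.eval (r : ℝ)} := by
  refine ⟨1, one_pos, 6144000, by norm_num, 1, fun r n ρ α β γ hr hρ hγ hn => ?_⟩
  obtain ⟨hα₀, hβ₀⟩ : 0 < (α : ℝ) - γ ∧ 0 < (β : ℝ) - γ :=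
    ⟨sub_pos.2 (lt_min_iff.1 hγ).1, sub_pos.2 (lt_min_iff.1 hγ).2⟩
  set m : ℝ := min ((α : ℝ) - γ) ((β : ℝ) - γ)
  have hm : 0 < m := lt_min hα₀ hβ₀
  have hmβ : m ≤ β - γ := min_le_right _ _
  have hm₁ : m ≤ 1 := by linarith [β.2.2, γ.2.1]
  have hr₁ : (1 : ℝ) ≤ r := by exact_mod_cast one_le_two.trans hr
  have hn₀ : (0 : ℝ) < n := lt_of_lt_of_le (by positivity) hn
  have hrate : m ^ 6 * n ≤ r * ((β : ℝ) - γ) ^ 4 * n := by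
    gcongr
    calc m ^ 6 ≤ m ^ 4 := pow_le_pow_of_le_one hm.le hm₁ (by norm_num)
      _ ≤ 1 * ((β : ℝ) - γ) ^ 4 := by rw [one_mul]; gcongr
      _ ≤ r * ((β : ℝ) - γ) ^ 4 := by gcongr
  have hprob := mainTheorem2_general hr (Nat.cast_pos.1 hn₀) r.lt_succ_self
    ((le_max_left α β).trans hρ.le) (lt_min_iff.1 hγ).2 (δ := 0.001) (by norm_num)
  refine le_trans (by norm_num) (hprob.trans (measureReal_mono fun G hG φ hφ => ?_))
  obtain ⟨h, hlin, hloss⟩ := hG φ hφ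
  refine ⟨h, hlin, hloss.trans ?_⟩
  calc 6144 / (0.001 * r * ((β : ℝ) - γ) ^ 4 * n)
      = 6144000 * (1 / (r * ((β : ℝ) - γ) ^ 4 * n)) := by field_simp; norm_num
    _ ≤ 6144000 * (1 / (m ^ 6 * n)) * (1 : Polynomial ℝ).eval (r : ℝ) := by
      rw [Polynomial.eval_one, mul_one]
      gcongr
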